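/- Let $\mathcal{C}$ be an additive category which is idempotent complete, i.e. every idempotent endomorphism $e:X\to X$ factors as $e=ip$ with $p:X\to Y$, $i:Y\to X$ and $pi=1_Y$. Call an object $K$ of $\mathcal{C}$ compact if for every direct sum (coproduct) $\bigoplus_{i\in I}X_i$ that exists in $\mathcal{C}$ and every morphism $f:K\to\bigoplus_{i\in I}X_i$ there is a finite subset $F\subseteq I$ such that $f$ factors through the canonical morphism $\bigoplus_{i\in F}X_i\to\bigoplus_{i\in I}X_i$. Suppose that $\mathcal{C}$ has enough compact objects, i.e. for every non-zero object $B$ of $\mathcal{C}$ there are a compact object $K$ and a non-zero morphism $K\to B$. Let $(A_i)_{i\in I}$ be a family of objects of $\mathcal{C}$ with local endomorphism rings whose direct sum $\bigoplus_{i\in I}A_i$ exists in $\mathcal{C}$ (as is automatic if $\mathcal{C}$ has all direct sums). (a) If $B$ is an indecomposable object and $\bigoplus_{i\in I}A_i\cong B\oplus D$ for some object $D$, then there exists $i\in I$ such that $B\cong A_i$. (b) If $(B_j)_{j\in J}$ is a family of indecomposable objects whose direct sum exists in $\mathcal{C}$ and $\bigoplus_{i\in I}A_i\cong\bigoplus_{j\in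 J}B_j$, then there exists a bijection $\sigma:I\to J$ such that $A_i\cong B_{\sigma(i)}$ for every $i\in I$. Here an object $X$ is indecomposable if $X\neq 0$ and $X\cong Y\oplus Z$ implies $Y=0$ or $Z=0$. -/

import Mathlib

open CategoryTheory CategoryTheory.Limits

universe w v u

/-- An object `K` of an additive category is compact if every morphism from `K` into a direct sum
`⊕_{i ∈ I} A i` factors through the canonical morphism `⊕_{j ∈ J} A j ⟶ ⊕_{i ∈ I} A i` for some
finite `J ⊆ I`. A direct sum is any colimit cofan `c`; all those that exist in the category, with
index set in `Type w`, are considered. -/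
def IsCompactObj {C : Type u} [Category.{v} C] [Preadditive C] [HasFiniteBiproducts C]
    (K : C) : Prop :=
  ∀ (I : Type w) (A : I → C) (c : Cofan A), Nonempty (IsColimit c) → ∀ f : K ⟶ c.pt,
    ∃ (J : Finset I) (g : K ⟶ ⨁ (fun j : J => A j)),
      g ≫ biproduct.desc (fun j : J => c.inj (j : I)) = f

/-- There are enough compact objects if every nonzero object receives a nonzero morphism from a
compact object. -/
def HasEnoughCompacts (C : Type u) [Category.{v} C] [Preadditive C] [HasFiniteBiproducts C] :
    Prop :=
  ∀ B : C, ¬ IsZero B → ∃ (K : C) (f : K ⟶ B), IsCompactObj.{w} K ∧ f ≠ 0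

/-- `B` is a direct summand of `X`: there is a decomposition `X ≅ B ⊕ D`. -/
def IsDirectSummand {C : Type u} [Category.{v} C] [Preadditive C] [HasBinaryBiproducts C]
    (B X : C) : Prop :=
  ∃ D : C, Nonempty (X ≅ B ⊞ D)

/-! If `K` is compact, every `f : K ⟶ ⨁ Aᵢ` satisfies `f ≫ ∑ i ∈ F, πᵢ ≫ ιᵢ = f` for some finite
`F`. Let `s : X ⟶ ⨁ Aᵢ` be a split monomorphism with retraction `t`, where `X` is nonzero. If no
`s ≫ πᵢ` were a split epimorphism, then every `s ≫ πᵢ ≫ ιᵢ ≫ t` would lie in the Jacobson radical of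
`End X`, because `End Aᵢ` is local; but some finite sum of these fixes a nonzero map from a compact
object to `X`. Hence some `s ≫ πᵢ` is a split epimorphism, and it is an isomorphism when `X` is
indecomposable.

For (b), let `T` have a local endomorphism ring. The number of `i` with `Aᵢ ≅ T` is an invariant of
`X = ⨁ Aᵢ`: it is the dimension of `Hom(T, X)` modulo the maps that are not split monomorphisms,
over the residue division ring of `End T`. -/

section Ring

open MulOpposite

variable {R : Type*} [Ring R]

theorem mem_ringJacobson_iff {x : R} :
    x ∈ Ring.jacobson R ↔ ∀ y, ∃ z, z * (1 + y * x) = 1 := by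
  simp only [← Ideal.jacobson_bot, Ideal.mem_jacobson_iff, Ideal.mem_bot, sub_eq_zero, mul_add,
    mul_one, mul_assoc, add_comm]

theorem nonempty_equiv_of_ker_eq {M ι κ : Type*} [AddCommGroup M] [Module R M] {I : Ideal R}
    [I.IsTwoSided] [InvariantBasisNumber (R ⧸ I)] {f : M →ₗ[R] ι →₀ R ⧸ I} {g : M →ₗ[R] κ →₀ R ⧸ I}
    (hf : Function.Surjective f) (hg : Function.Surjective g) (h : f.ker = g.ker) :
    Nonempty (ι ≃ κ) := by
  let e : (ι →₀ R ⧸ I) ≃ₗ[R] (κ →₀ R ⧸ I) :=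
    (f.quotKerEquivOfSurjective hf).symm ≪≫ₗ Submodule.quotEquivOfEq _ _ h ≪≫ₗ
      g.quotKerEquivOfSurjective hg
  have he (c : R ⧸ I) (x : ι →₀ R ⧸ I) : e (c • x) = c • e x := by
    obtain ⟨r, rfl⟩ := Ideal.Quotient.mk_surjective c
    exact e.map_smul r x
  let e' : (ι →₀ R ⧸ I) ≃ₗ[R ⧸ I] (κ →₀ R ⧸ I) := { e with map_smul' := he }
  exact ⟨(Finsupp.basisSingleOne.map e').indexEquiv Finsupp.basisSingleOne⟩

variable [IsLocalRing R]

theorem eq_zero_or_eq_one_of_isIdempotentElem {e : R} (he : IsIdempotentElem e) :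
    e = 0 ∨ e = 1 := by
  rcases IsLocalRing.isUnit_or_isUnit_of_add_one (add_sub_cancel e 1) with h | h
  · exact .inr (h.mul_left_cancel (by rw [he.eq, mul_one]))
  · exact .inl (h.mul_left_cancel (by rw [he.one_sub_mul_self, mul_zero]))

variable (R) in
theorem isDedekindFiniteMonoid_of_isLocalRing : IsDedekindFiniteMonoid R where
  mul_eq_one_symm {x y} h := by
    have he : IsIdempotentElem (y * x) := by
      rw [IsIdempotentElem, mul_assoc, ← mul_assoc x, h, one_mul]
    refine (eq_zero_or_eq_one_of_isIdempotentElem he).resolve_left fun h0 => ?_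
    refine one_ne_zero (α := R) ?_
    calc (1 : R) = x * (y * x) * y := by rw [← mul_assoc, h, one_mul, h]
      _ = 0 := by rw [h0, mul_zero, zero_mul]

theorem mem_ringJacobson_iff_not_isUnit {x : R} : x ∈ Ring.jacobson R ↔ ¬ IsUnit x := by
  have := isDedekindFiniteMonoid_of_isLocalRing R
  rw [mem_ringJacobson_iff]
  refine ⟨?_, fun hx y => ?_⟩
  · rintro h ⟨u, rfl⟩
    obtain ⟨z, hz⟩ := h (-↑u⁻¹)
    simp at hz
  · have hyx : ¬ IsUnit (-(y * x)) := fun h => by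
      obtain ⟨c, hc⟩ := (IsUnit.neg_iff _).1 h |>.exists_left_inv
      exact hx (.of_mul_eq_one_right (c * y) (by rw [mul_assoc, hc]))
    simpa using (IsLocalRing.isUnit_or_isUnit_of_add_one
      (by abel : -(y * x) + (1 + y * x) = 1)).resolve_left hyx |>.exists_left_inv

variable (R) in
theorem invariantBasisNumber_quotient_ringJacobson :
    InvariantBasisNumber (R ⧸ Ring.jacobson R) := by
  have : Nontrivial (R ⧸ Ring.jacobson R) :=
    Ideal.Quotient.nontrivial_iff.2 (Ring.jacobson_lt_top R).ne
  let : DivisionRing (R ⧸ Ring.jacobson R) := .ofIsUnitOrEqZero fun q => by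
    obtain ⟨x, rfl⟩ := Ideal.Quotient.mk_surjective q
    rw [Ideal.Quotient.eq_zero_iff_mem, mem_ringJacobson_iff_not_isUnit]
    exact (em (IsUnit x)).imp_left fun hx => hx.map _
  infer_instance

variable (R) in
theorem isLocalRing_mulOpposite : IsLocalRing Rᵐᵒᵖ where
  isUnit_or_isUnit_of_add_one {x y} h := by
    simpa using IsLocalRing.isUnit_or_isUnit_of_add_one (a := x.unop) (b := y.unop)
      (congrArg unop h)

end Ring

section Preadditive

variable {C : Type u} [Category.{v} C] [Preadditive C]

theorem isSplitMono_id_add_comp_swap {X Y : C} (f : X ⟶ Y) (g : Y ⟶ X)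
    [IsSplitMono (𝟙 X + f ≫ g)] : IsSplitMono (𝟙 Y + g ≫ f) := by
  have ht := IsSplitMono.id (𝟙 X + f ≫ g)
  generalize retraction (𝟙 X + f ≫ g) = t at ht
  refine .mk' ⟨𝟙 Y - g ≫ t ≫ f, ?_⟩
  calc (𝟙 Y + g ≫ f) ≫ (𝟙 Y - g ≫ t ≫ f)
      = 𝟙 Y + g ≫ f - g ≫ ((𝟙 X + f ≫ g) ≫ t) ≫ f := by
        simp only [Preadditive.comp_sub, Preadditive.add_comp, Preadditive.comp_add,
          Category.id_comp, Category.comp_id, Category.assoc]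
    _ = 𝟙 Y := by rw [ht, Category.id_comp, add_sub_cancel_right]

theorem comp_mem_ringJacobson_of_not_isSplitEpi {X Y : C} [IsLocalRing (End Y)] {f : X ⟶ Y}
    (hf : ¬ IsSplitEpi f) (g : Y ⟶ X) : End.of (f ≫ g) ∈ Ring.jacobson (End X) := by
  refine mem_ringJacobson_iff.2 fun y => ?_
  let u := End.of ((g ≫ y.asHom) ≫ f)
  have hu : ¬ IsUnit (-u) := fun h => by
    obtain ⟨v, hv⟩ := ((IsUnit.neg_iff u).1 h).exists_right_inv
    exact hf (.mk' ⟨v.asHom ≫ g ≫ y.asHom, (Category.assoc v.asHom (g ≫ y.asHom) f).trans hv⟩)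
  have : IsIso (𝟙 Y + (g ≫ y.asHom) ≫ f) := (isUnit_iff_isIso _).1
    ((IsLocalRing.isUnit_or_isUnit_of_add_one (neg_add_cancel_comm_assoc u 1)).resolve_left hu)
  have := isSplitMono_id_add_comp_swap (g ≫ y.asHom) f
  rw [← Category.assoc f] at this
  exact ⟨_, IsSplitMono.id (𝟙 X + (f ≫ g) ≫ y.asHom)⟩

theorem eq_zero_of_comp_eq_self_of_mem_ringJacobson {K X : C} {x : X ⟶ X}
    (hx : End.of x ∈ Ring.jacobson (End X)) {f : K ⟶ X} (hf : f ≫ x = f) : f = 0 := by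
  obtain ⟨z, hz⟩ := mem_ringJacobson_iff.1 hx (-1)
  have hz' : (𝟙 X - x) ≫ z.asHom = 𝟙 X := by
    rw [neg_one_mul, ← sub_eq_add_neg] at hz
    exact hz
  calc f = f ≫ (𝟙 X - x) ≫ z.asHom := by rw [hz', Category.comp_id]
    _ = 0 := by
      rw [← Category.assoc, Preadditive.comp_sub, hf, Category.comp_id, sub_self, zero_comp]

theorem not_isZero_of_nontrivial_end (X : C) [Nontrivial (End X)] : ¬ IsZero X := fun h =>
  one_ne_zero (α := End X) (h.eq_of_src _ _)

theorem isLocalRing_end_of_iso {X Y : C} (e : X ≅ Y) [IsLocalRing (End X)] :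
    IsLocalRing (End Y) := by
  have conj_add (f g : End X) : e.conj (f + g) = e.conj f + e.conj g := by
    change e.inv ≫ (f + g) ≫ e.hom = e.inv ≫ f ≫ e.hom + e.inv ≫ g ≫ e.hom
    rw [Preadditive.add_comp, Preadditive.comp_add]
  let c : End X ≃+* End Y := { e.conj with map_add' := conj_add }
  have : Nontrivial (End Y) := c.symm.toEquiv.nontrivial
  refine ⟨fun {a b} h => ?_⟩
  simpa using IsLocalRing.isUnit_or_isUnit_of_add_one
    (by rw [← map_add, h, map_one] : c.symm a + c.symm b = 1)

theorem isIso_of_isSplitEpi_of_idempotents {X Z : C}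
    (hX : ∀ e : End X, IsIdempotentElem e → e = 0 ∨ e = 1) (hZ : ¬ IsZero Z) (p : X ⟶ Z)
    [IsSplitEpi p] : IsIso p := by
  have he : IsIdempotentElem (M := End X) (p ≫ section_ p) := by
    simp [IsIdempotentElem, End.mul_def]
  rcases hX _ he with h0 | h1
  · have h0' : p ≫ section_ p = 0 := h0
    refine absurd ((IsZero.iff_id_eq_zero Z).2 ?_) hZ
    calc 𝟙 Z = section_ p ≫ (p ≫ section_ p) ≫ p := by simp
      _ = 0 := by rw [h0', zero_comp, comp_zero]
  · exact ⟨section_ p, h1, IsSplitEpi.id p⟩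

theorem eq_zero_or_eq_one_of_indecomposable [HasBinaryBiproducts C] [IsIdempotentComplete C]
    {B : C} (hB : Indecomposable B) {e : End B} (he : IsIdempotentElem e) : e = 0 ∨ e = 1 := by
  obtain ⟨Y, i, p, hip, hpi⟩ := IsIdempotentComplete.idempotents_split B e he
  obtain ⟨Z, j, q, hjq, hqj⟩ :=
    IsIdempotentComplete.idempotents_split B _ (Idempotents.idem_of_id_sub_idem e he)
  have hiq : i ≫ q = 0 := by
    calc i ≫ q = (i ≫ q ≫ j) ≫ q := by simp only [Category.assoc, hjq, Category.comp_id]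
      _ = 0 := by
        rw [hqj, ← hpi, Preadditive.comp_sub, Category.comp_id, ← Category.assoc, hip,
          Category.id_comp, sub_self, zero_comp]
  have hjp : j ≫ p = 0 := by
    calc j ≫ p = j ≫ (q ≫ j) ≫ p := by
          rw [Category.assoc, ← Category.assoc j, hjq, Category.id_comp]
      _ = 0 := by
        rw [hqj, ← hpi, Preadditive.sub_comp, Category.id_comp, Category.assoc, hip,
          Category.comp_id, sub_self, comp_zero]
  let φ : B ≅ Y ⊞ Z :=
    { hom := biprod.lift p q
      inv := biprod.desc i j
      hom_inv_id := by rw [biprod.lift_desc, hpi, hqj, add_sub_cancel]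
      inv_hom_id := by ext <;> simp [hip, hiq, hjp, hjq] }
  refine (hB.2 Y Z φ).imp (fun hY => ?_) fun hZ => ?_
  · rw [← hpi, hY.eq_of_tgt p 0, zero_comp]
  · rw [hZ.eq_of_tgt q 0, zero_comp] at hqj
    exact (sub_eq_zero.1 hqj.symm).symm

end Preadditive

section Cofan

variable {C : Type u} [Category.{v} C] [Preadditive C]

open Classical in
/-- The projection of a coproduct onto its `i`-th component. -/
noncomputable def cofanProj {I : Type*} {A : I → C} {a : Cofan A} (ha : IsColimit a) (i : I) :
    a.pt ⟶ A i :=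
  Cofan.IsColimit.desc ha fun j => if h : j = i then eqToHom (by rw [h]) else 0

section

variable {I : Type*} {A : I → C} {a : Cofan A} (ha : IsColimit a)

theorem inj_cofanProj_self (i : I) : a.inj i ≫ cofanProj ha i = 𝟙 (A i) := by
  simp [cofanProj]

theorem inj_cofanProj_of_ne {i j : I} (h : j ≠ i) : a.inj j ≫ cofanProj ha i = 0 := by
  simp [cofanProj, h]

end

variable {I : Type w} {A : I → C} {a : Cofan A} (ha : IsColimit a) [HasFiniteBiproducts C]

theorem IsCompactObj.exists_comp_sum_eq {K : C} (hK : IsCompactObj.{w} K) (f : K ⟶ a.pt) :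
    ∃ F : Finset I, f ≫ ∑ i ∈ F, cofanProj ha i ≫ a.inj i = f := by
  obtain ⟨F, g, rfl⟩ := hK I A a ⟨ha⟩ f
  refine ⟨F, ?_⟩
  rw [Category.assoc]
  congr 1
  ext j
  rw [biproduct.ι_desc_assoc, biproduct.ι_desc, Preadditive.comp_sum,
    Finset.sum_eq_single_of_mem (j : I) j.2, ← Category.assoc, inj_cofanProj_self, Category.id_comp]
  intro i _ hij
  rw [← Category.assoc, inj_cofanProj_of_ne ha hij.symm, zero_comp]

theorem finite_setOf_mono_comp_cofanProj (hC : HasEnoughCompacts.{w} C) {X : C} (hX : ¬ IsZero X)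
    (f : X ⟶ a.pt) : {i | Mono (f ≫ cofanProj ha i)}.Finite := by
  obtain ⟨K, k, hK, hk⟩ := hC X hX
  obtain ⟨F, hF⟩ := hK.exists_comp_sum_eq ha (k ≫ f)
  refine F.finite_toSet.subset fun i (hi : Mono _) => ?_
  by_contra hiF
  refine hk (zero_of_comp_mono (f ≫ cofanProj ha i) ?_)
  rw [← Category.assoc, ← hF, Category.assoc, Preadditive.sum_comp, Finset.sum_eq_zero, comp_zero]
  intro j hj
  rw [Category.assoc, inj_cofanProj_of_ne ha (ne_of_mem_of_not_mem hj hiF), comp_zero]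

theorem exists_isSplitEpi_comp_cofanProj (hC : HasEnoughCompacts.{w} C)
    [∀ i, IsLocalRing (End (A i))] {X : C} (hX : ¬ IsZero X) (s : X ⟶ a.pt) [IsSplitMono s] :
    ∃ i, IsSplitEpi (s ≫ cofanProj ha i) := by
  by_contra! hs
  let x (i : I) : X ⟶ X := (s ≫ cofanProj ha i) ≫ a.inj i ≫ retraction s
  have hx (F : Finset I) : End.of (∑ i ∈ F, x i) ∈ Ring.jacobson (End X) :=
    Ideal.sum_mem _ fun i _ => comp_mem_ringJacobson_of_not_isSplitEpi (hs i) _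
  obtain ⟨K, f, hK, hf⟩ := hC X hX
  obtain ⟨F, hF⟩ := hK.exists_comp_sum_eq ha (f ≫ s)
  refine hf (eq_zero_of_comp_eq_self_of_mem_ringJacobson (hx F) ?_)
  simpa [x, Preadditive.sum_comp, Preadditive.comp_sum] using hF =≫ retraction s

theorem exists_isIso_comp_cofanProj (hC : HasEnoughCompacts.{w} C) [∀ i, IsLocalRing (End (A i))]
    {X : C} (hX : ¬ IsZero X) (hidem : ∀ e : End X, IsIdempotentElem e → e = 0 ∨ e = 1)
    (s : X ⟶ a.pt) [IsSplitMono s] : ∃ i, IsIso (s ≫ cofanProj ha i) := by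
  obtain ⟨i, hi⟩ := exists_isSplitEpi_comp_cofanProj ha hC hX s
  exact ⟨i, isIso_of_isSplitEpi_of_idempotents hidem (not_isZero_of_nontrivial_end (A i)) _⟩

end Cofan

section Multiplicity

variable {C : Type u} [Category.{v} C] [Preadditive C]

open MulOpposite

/-- Postcomposition with `g`, as a map of left modules over `(End T)ᵐᵒᵖ`. -/
def postcomp (T : C) {X Y : C} (g : X ⟶ Y) : (T ⟶ X) →ₗ[(End T)ᵐᵒᵖ] (T ⟶ Y) where
  toFun f := f ≫ g
  map_add' f f' := Preadditive.add_comp _ _ _ f f' g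
  map_smul' r f := Category.assoc r.unop f g

/-- The endomorphism ring of `T` modulo its Jacobson radical, with the order of multiplication
reversed so that it acts from the left on morphisms out of `T`. -/
abbrev ResidueRing (T : C) : Type v := (End T)ᵐᵒᵖ ⧸ Ring.jacobson (End T)ᵐᵒᵖ

/-- The quotient map onto the residue ring of `T`, as a map of left modules. -/
def residue (T : C) : (T ⟶ T) →ₗ[(End T)ᵐᵒᵖ] ResidueRing T where
  toFun f := Ideal.Quotient.mk _ (op (End.of f))
  map_add' _ _ := rfl
  map_smul' _ _ := rfl

theorem residue_surjective (T : C) : Function.Surjective (residue T) := fun q => by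
  obtain ⟨r, rfl⟩ := Ideal.Quotient.mk_surjective q
  exact ⟨r.unop, rfl⟩

theorem residue_eq_zero_iff {T : C} [IsLocalRing (End T)] {f : T ⟶ T} :
    residue T f = 0 ↔ ¬ IsIso f := by
  have := isLocalRing_mulOpposite (End T)
  have h : IsUnit (op (End.of f)) ↔ IsIso f := isUnit_op.trans (isUnit_iff_isIso f)
  rw [← h, ← mem_ringJacobson_iff_not_isUnit]
  exact Ideal.Quotient.eq_zero_iff_mem

variable [HasFiniteBiproducts C]

section

variable {I : Type w} {A : I → C} {a : Cofan A} (ha : IsColimit a) (hC : HasEnoughCompacts.{w} C)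
  (T : C) [IsLocalRing (End T)]

/-- The coordinates of a morphism `f : T ⟶ ⊕ A i` at the components `A i` isomorphic to `T`, read
in the residue ring of `T` through a chosen isomorphism. -/
noncomputable def coords :
    (T ⟶ a.pt) →ₗ[(End T)ᵐᵒᵖ] {i // Nonempty (A i ≅ T)} →₀ ResidueRing T where
  toFun f := Finsupp.ofSupportFinite
    (fun i => (residue T ∘ₗ postcomp T (cofanProj ha i ≫ i.2.some.hom)) f) <| by
      refine ((finite_setOf_mono_comp_cofanProj ha hC (not_isZero_of_nontrivial_end T) f).preimage
        Subtype.val_injective.injOn).subset fun i hi => ?_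
      have : IsIso (f ≫ cofanProj ha i ≫ i.2.some.hom) := not_not.1 (mt residue_eq_zero_iff.2 hi)
      rw [← Category.assoc] at this
      exact mono_of_mono _ i.2.some.hom
  map_add' f f' := Finsupp.ext fun i =>
    (residue T ∘ₗ postcomp T (cofanProj ha i ≫ i.2.some.hom)).map_add f f'
  map_smul' r f := Finsupp.ext fun i =>
    (residue T ∘ₗ postcomp T (cofanProj ha i ≫ i.2.some.hom)).map_smul r f

theorem coords_apply (f : T ⟶ a.pt) (i : {i // Nonempty (A i ≅ T)}) :
    coords ha hC T f i = residue T (f ≫ cofanProj ha i ≫ i.2.some.hom) := rfl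

theorem coords_surjective : Function.Surjective (coords ha hC T) := fun x => by
  classical
  induction x using Finsupp.induction_linear with
  | zero => exact ⟨0, map_zero _⟩
  | add x y hx hy =>
    obtain ⟨f, rfl⟩ := hx
    obtain ⟨g, rfl⟩ := hy
    exact ⟨f + g, map_add _ f g⟩
  | single i q =>
    obtain ⟨r, rfl⟩ := residue_surjective T q
    refine ⟨r ≫ i.2.some.inv ≫ a.inj i, Finsupp.ext fun j => ?_⟩
    rw [coords_apply]
    obtain rfl | hij := eq_or_ne i j
    · simp [← Category.assoc (a.inj _), inj_cofanProj_self]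
    · simp [← Category.assoc (a.inj _), inj_cofanProj_of_ne ha (Subtype.coe_ne_coe.2 hij),
        Finsupp.single_eq_of_ne' hij]

theorem coords_eq_zero_iff [∀ i, IsLocalRing (End (A i))] {f : T ⟶ a.pt} :
    coords ha hC T f = 0 ↔ ¬ IsSplitMono f := by
  simp only [Finsupp.ext_iff, Finsupp.zero_apply, coords_apply, residue_eq_zero_iff]
  rw [← not_exists, not_iff_not]
  constructor
  · rintro ⟨i, hi⟩
    exact .mk' ⟨(cofanProj ha i ≫ i.2.some.hom) ≫ inv (f ≫ cofanProj ha i ≫ i.2.some.hom),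
      by rw [← Category.assoc, IsIso.hom_inv_id]⟩
  · intro hf
    obtain ⟨i, hi⟩ := exists_isIso_comp_cofanProj ha hC (not_isZero_of_nontrivial_end T)
      (fun _ => eq_zero_or_eq_one_of_isIdempotentElem) f
    refine ⟨⟨i, ⟨(asIso (f ≫ cofanProj ha i)).symm⟩⟩, ?_⟩
    rw [← Category.assoc]
    infer_instance

end

variable {I J : Type w} {A : I → C} {B : J → C} {a : Cofan A} {b : Cofan B}

theorem nonempty_subtype_iso_equiv_of_isLocalRing (hC : HasEnoughCompacts.{w} C) (ha : IsColimit a)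
    (hb : IsColimit b) [∀ i, IsLocalRing (End (A i))] [∀ j, IsLocalRing (End (B j))]
    (φ : a.pt ≅ b.pt) (T : C) [IsLocalRing (End T)] :
    Nonempty ({i // Nonempty (A i ≅ T)} ≃ {j // Nonempty (B j ≅ T)}) := by
  have := isLocalRing_mulOpposite (End T)
  have := invariantBasisNumber_quotient_ringJacobson (End T)ᵐᵒᵖ
  have hφ : Function.Surjective (postcomp T φ.hom) := fun f => ⟨f ≫ φ.inv, by simp [postcomp]⟩
  have hsplit (f : T ⟶ a.pt) : IsSplitMono f ↔ IsSplitMono (f ≫ φ.hom) :=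
    ⟨fun _ => inferInstance, fun _ => .mk' ⟨φ.hom ≫ retraction (f ≫ φ.hom), by
      rw [← Category.assoc, IsSplitMono.id]⟩⟩
  refine nonempty_equiv_of_ker_eq (coords_surjective ha hC T)
    (g := coords hb hC T ∘ₗ postcomp T φ.hom) ((coords_surjective hb hC T).comp hφ) ?_
  ext f
  calc coords ha hC T f = 0 ↔ ¬ IsSplitMono f := coords_eq_zero_iff ha hC T
    _ ↔ ¬ IsSplitMono (f ≫ φ.hom) := not_congr (hsplit f)
    _ ↔ coords hb hC T (f ≫ φ.hom) = 0 := (coords_eq_zero_iff hb hC T).symm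

theorem nonempty_subtype_iso_equiv (hC : HasEnoughCompacts.{w} C) (ha : IsColimit a)
    (hb : IsColimit b) [∀ i, IsLocalRing (End (A i))] [∀ j, IsLocalRing (End (B j))]
    (φ : a.pt ≅ b.pt) (T : C) :
    Nonempty ({i // Nonempty (A i ≅ T)} ≃ {j // Nonempty (B j ≅ T)}) := by
  by_cases hT : IsLocalRing (End T)
  · exact nonempty_subtype_iso_equiv_of_isLocalRing hC ha hb φ T
  · have : IsEmpty {i // Nonempty (A i ≅ T)} := ⟨fun i => hT (isLocalRing_end_of_iso i.2.some)⟩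
    have : IsEmpty {j // Nonempty (B j ≅ T)} := ⟨fun j => hT (isLocalRing_end_of_iso j.2.some)⟩
    exact ⟨Equiv.equivOfIsEmpty _ _⟩

theorem exists_equiv_nonempty_iso (hC : HasEnoughCompacts.{w} C) (ha : IsColimit a)
    (hb : IsColimit b) [∀ i, IsLocalRing (End (A i))] [∀ j, IsLocalRing (End (B j))]
    (φ : a.pt ≅ b.pt) : ∃ σ : I ≃ J, ∀ i, Nonempty (A i ≅ B (σ i)) := by
  have h (c : Quotient (isIsomorphicSetoid C)) :
      Nonempty ({i // (⟦A i⟧ : Quotient (isIsomorphicSetoid C)) = c} ≃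
        {j // (⟦B j⟧ : Quotient (isIsomorphicSetoid C)) = c}) := by
    induction c using Quotient.inductionOn with
    | h T =>
      simp only [Quotient.eq]
      exact nonempty_subtype_iso_equiv hC ha hb φ T
  exact ⟨.ofFiberEquiv fun c => (h c).some,
    fun i => Quotient.exact (Equiv.ofFiberEquiv_map (fun c => (h c).some) i).symm⟩

end Multiplicity

theorem exists_iso_of_indecomposable_of_isSplitMono {C : Type u} [Category.{v} C] [Preadditive C]
    [HasFiniteBiproducts C] [HasBinaryBiproducts C] [IsIdempotentComplete C]
    (hC : HasEnoughCompacts.{w} C) {I : Type w} {A : I → C} [∀ i, IsLocalRing (End (A i))]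
    {a : Cofan A} (ha : IsColimit a) {B : C} (hB : Indecomposable B) (s : B ⟶ a.pt)
    [IsSplitMono s] : ∃ i, Nonempty (B ≅ A i) := by
  obtain ⟨i, hi⟩ := exists_isIso_comp_cofanProj ha hC hB.1
    (fun _ => eq_zero_or_eq_one_of_indecomposable hB) s
  exact ⟨i, ⟨asIso (s ≫ cofanProj ha i)⟩⟩

theorem theorem4p1 {C : Type u} [Category.{v} C] [Preadditive C] [HasFiniteBiproducts C]
    [HasBinaryBiproducts C] [IsIdempotentComplete C] (hC : HasEnoughCompacts.{w} C)
    {I : Type w} (A : I → C) (hA : ∀ i, IsLocalRing (End (A i)))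
    (a : Cofan A) (ha : IsColimit a) :
    (∀ B : C, Indecomposable B → IsDirectSummand B a.pt → ∃ i, Nonempty (B ≅ A i)) ∧
    (∀ (J : Type w) (B : J → C) (b : Cofan B), IsColimit b → (∀ j, Indecomposable (B j)) →
      Nonempty (a.pt ≅ b.pt) → ∃ σ : I ≃ J, ∀ i, Nonempty (A i ≅ B (σ i))) := by
  have := hA
  constructor
  · rintro B hB ⟨D, ⟨ψ⟩⟩
    exact exists_iso_of_indecomposable_of_isSplitMono hC ha hB (biprod.inl ≫ ψ.inv)
  · rintro J B b hb hB ⟨φ⟩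
    have hBlocal (j : J) : IsLocalRing (End (B j)) := by
      have : IsSplitMono (b.inj j) := .mk' ⟨cofanProj hb j, inj_cofanProj_self hb j⟩
      obtain ⟨i, ⟨e⟩⟩ :=
        exists_iso_of_indecomposable_of_isSplitMono hC ha (hB j) (b.inj j ≫ φ.inv)
      exact isLocalRing_end_of_iso e.symm
    exact exists_equiv_nonempty_iso hC ha hb φ
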